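/- Let $S$ be a non-empty string over an arbitrary alphabet $\Sigma$, let $\$\notin\Sigma$ be an end marker, and put $S[0]=S[|S|+1]=\$$. The (self-referential) LZ77-decomposition of $S$ is the factorization $S=F_1F_2\cdots F_z$ into non-empty factors such that each $F_i$ is either a single character that does not occur in $F_1\cdots F_{i-1}$, or the longest prefix of $S[|F_1\cdots F_{i-1}|+1..|S|]$ that occurs at least twice (possibly overlapping) in $F_1\cdots F_i$, with $F_i$ itself being that prefix. A maximal pair of $S$ is a triple $(n,m,l)$ of natural numbers with $l\ge 1$, $n,m\ge 1$, $n+l\le|S|+1$ and $m+l\le|S|+1$ such that $S[n..n+l-1]=S[m..m+l-1]$, $S[n-1]\ne S[m-1]$ and $S[n+l]\ne S[m+l]$; the (non-empty) string $S[n..n+l-1]$ is then called a maximal repeat of $S$. A right extension of a maximal repeat $P$ is a string $Pc$ with $c\in\Sigma\cup\{\$\}$ that is a substring of $S\$$. The compacted directed acyclic word graph (CDAWG) of $S$, built on the terminated string $S\$$, is the following labelled graph. For a substring $x$ of $S\$$, let $\operatorname{imp}(x)=\alpha x\beta$ with $\alpha,\beta$ the longest strings such that every occurrence of $x$ in $S\$$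 is immediately preceded by $\alpha$ and followed by $\beta$. The nodes are the substrings $x$ of $S\$$ with $\operatorname{imp}(x)=x$ (including the empty string, which is the root). For every node $x$ and every character $c$ such that $xc$ is a substring of $S\$$, with $\operatorname{imp}(xc)=\alpha xc\beta$, there is an arc from $x$ to $\alpha xc\beta$ with label $c\beta$. **Theorem.** Let $S$ be a non-empty string and let $z$ be the number of factors in its LZ77-decomposition. Let $q$ be a natural number such that $S$ contains no $q$-th power, i.e. there is no non-empty string $P$ such that $P^q$ is a substring of $S$ (this forces $q\ge 2$). Then the number of distinct right extensions of maximal repeats of $S$ is at most $$18q\,(1+\log_q|S|)\,(z+2)^2-(z+1),$$ and the CDAWG of $S$ has at most $$18q\,(1+\log_q|S|)\,(z+2)^2$$ arcs. -/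

import Mathlib

namespace RepeatWord

variable {α : Type*}

/-- The starting positions (counted from `0`) of the occurrences of `u` in `w`. -/
def occurrences (w u : List α) : Set ℕ :=
  {k | ∃ a b : List α, w = a ++ u ++ b ∧ a.length = k}

/-- `u` occurs at least twice in `w` (the two occurrences may overlap). -/
def OccursTwice (w u : List α) : Prop := (occurrences w u).Nontrivial

/-- `S` contains a `q`-th power, i.e. `P ^ q` is a substring of `S` for some non-empty `P`. -/
def ContainsPower (q : ℕ) (S : List α) : Prop :=
  ∃ P : List α, P ≠ [] ∧ (List.replicate q P).flatten <:+: S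

/-- `F` is the (self-referential) LZ77-decomposition of `S`: every factor is either a character
that does not occur in the preceding factors, or it is the longest (non-empty) prefix of the
remaining string that occurs at least twice in the concatenation of the preceding factors and
itself. -/
def IsLZ77 (S : List α) (F : List (List α)) : Prop :=
  F.flatten = S ∧
  ∀ (i : ℕ) (hi : i < F.length),
    (∃ c : α, F[i] = [c] ∧ c ∉ (F.take i).flatten) ∨
    (F[i] ≠ [] ∧ OccursTwice ((F.take i).flatten ++ F[i]) F[i] ∧
      ∀ G : List α, G <+: S.drop (F.take i).flatten.length →
        OccursTwice ((F.take i).flatten ++ G) G → G.length ≤ F[i].length)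

/-- The character `S[i]` (counted from `1`). The end marker `$`, which is not in the alphabet, is
`none`; it is the value at `0` and at `|S| + 1`. -/
def charAt (S : List α) (i : ℕ) : Option α := if i = 0 then none else S[i - 1]?

/-- `(n, m, l)` is a maximal pair of `S`. The bounds say that all the characters
`S[n-1], …, S[n+l]` and `S[m-1], …, S[m+l]` have indices in `0, …, |S| + 1`. -/
structure IsMaximalPair (S : List α) (n m l : ℕ) : Prop where
  one_le_l : 1 ≤ l
  one_le_n : 1 ≤ n
  one_le_m : 1 ≤ m
  n_le : n + l ≤ S.length + 1
  m_le : m + l ≤ S.length + 1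
  eq : ∀ i < l, charAt S (n + i) = charAt S (m + i)
  left_ne : charAt S (n - 1) ≠ charAt S (m - 1)
  right_ne : charAt S (n + l) ≠ charAt S (m + l)

/-- `P` is a maximal repeat of `S`: the string `S[n..n+l-1]` of a maximal pair `(n, m, l)`. -/
def IsMaximalRepeat (S P : List α) : Prop :=
  ∃ n m l : ℕ, IsMaximalPair S n m l ∧ P = (S.drop (n - 1)).take l

/-- The string `S$`. -/
def terminated (S : List α) : List (Option α) := S.map some ++ [none]

/-- The right extensions of the maximal repeats of `S`: the substrings `Pc` of `S$`, where `P` is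
a maximal repeat of `S` and `c` is a character (possibly `$`). -/
def rightExtensions (S : List α) : Set (List (Option α)) :=
  {R | ∃ (P : List α) (c : Option α),
    IsMaximalRepeat S P ∧ R = P.map some ++ [c] ∧ R <:+: terminated S}

/-- Every occurrence of `x` in `w` is immediately preceded by `a` and followed by `b`. -/
def Forced (w x a b : List α) : Prop :=
  ∀ u v : List α, w = u ++ x ++ v → a <:+ u ∧ b <+: v

/-- `a ++ x ++ b` is the implication of the substring `x` of `w`: the longest string with the
property that every occurrence of `x` in `w` is preceded by `a` and followed by `b`. -/
def IsImplication (w x a b : List α) : Prop :=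
  Forced w x a b ∧ ∀ a' b' : List α, Forced w x a' b' → a'.length ≤ a.length ∧ b'.length ≤ b.length

/-- The nodes of the compacted directed acyclic word graph of `w`: the substrings of `w` that are
their own implication. -/
def cdawgNodes (w : List α) : Set (List α) :=
  {x | x <:+: w ∧ IsImplication w x [] []}

/-- The arcs `(x, label, y)` of the compacted directed acyclic word graph of `w`. For each node `x`
and each character `c` such that `xc` is a substring of `w`, with implication `y = a x c b`, there
is an arc from `x` to `y` with label `cb`. -/
def cdawgArcs (w : List α) : Set (List α × List α × List α) :=
  {e | ∃ (x : List α) (c : α) (a b : List α), x ∈ cdawgNodes w ∧ x ++ [c] <:+: w ∧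
    IsImplication w (x ++ [c]) a b ∧ e = (x, c :: b, a ++ (x ++ [c]) ++ b)}

/-- The head of an arc is a node. -/
theorem head_mem_cdawgNodes {w : List α} {e : List α × List α × List α}
    (he : e ∈ cdawgArcs w) : e.2.2 ∈ cdawgNodes w := by
  obtain ⟨x, c, a, b, -, ⟨u, v, huv⟩, ⟨hf, hmax⟩, rfl⟩ := he
  refine ⟨?_, fun u v h => ⟨List.nil_suffix, List.nil_prefix⟩, ?_⟩
  · obtain ⟨⟨u', rfl⟩, ⟨v', rfl⟩⟩ := hf u v huv.symm
    exact ⟨u', v', by simp [← huv]⟩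
  · intro a' b' h'
    have key : Forced w (x ++ [c]) (a' ++ a) (b ++ b') := by
      intro u v h
      obtain ⟨⟨u', rfl⟩, ⟨v', rfl⟩⟩ := hf u v h
      obtain ⟨⟨u'', rfl⟩, ⟨v'', rfl⟩⟩ := h' u' v' (by simp [h])
      exact ⟨⟨u'', by simp⟩, ⟨v'', by simp⟩⟩
    have := hmax _ _ key
    simp only [List.length_append] at this
    simp only [List.length_nil]
    omega

end RepeatWord

open RepeatWord

open RepeatWord
namespace RepeatWord

/-! Outside the fresh characters, every LZ77 factor is a copy of a string that starts further left.
Hence the leftmost occurrence of any string of length at least 2 in `$S$` straddles one of the at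
most z + 1 factor boundaries. Applied to a maximal repeat P with one more character on its right or
left, this moves occurrences of P to a boundary while keeping that character, so every right
extension Pc comes from a maximal pair whose two occurrences touch boundaries b and b'
(`exists_maximalPair_of_mem_rightExtensions`).

Fix b and b'. The pair is determined by its shift, the difference between the offsets of b and b' in
the two occurrences (`IsMaximalPair.unique`). A nonzero shift s yields a string of length s that
ends before one boundary and starts at the other. All such strings, for one sign of the shift, are
borders of the longest of them. A word without q-th powers of length m has at most 2q log_q m + 1
borders (`card_borders_le`), so each of the at most (z + 1)² pairs (b, b') admits at most 4q log_q
|S| + 3 shifts.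

For the CDAWG, an arc is determined by its tail x and the first character c of its label. If x is
non-empty, xc is a right extension of a maximal repeat; the arcs from the root number at most z + 1,
since every character occurs at a boundary. -/

/-! ### Periods and borders of words without high powers -/

/-- `p` is a period of the word `W 0, …, W (m - 1)`. -/
def HasPeriod {β : Type*} (W : ℕ → β) (m p : ℕ) : Prop := ∀ t, t + p < m → W t = W (t + p)

/-- The word `W 0, …, W (m - 1)` has a border of length `s`. -/
def IsBorder {β : Type*} (W : ℕ → β) (m s : ℕ) : Prop :=
  1 ≤ s ∧ s ≤ m ∧ ∀ t < s, W t = W (m - s + t)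

/-- From t, go back by p and forward by d if p ≤ t. Otherwise go forward by d first; t < p and p + d
≤ m keep this inside the word. -/
theorem HasPeriod.sub {β : Type*} {W : ℕ → β} {m p d : ℕ} (hp : HasPeriod W m p)
    (hd : HasPeriod W m d) (hpd : p ≤ d) (h : p + d ≤ m) : HasPeriod W m (d - p) := by
  intro t ht
  rcases le_or_gt p t with hpt | hpt
  · have h1 := hp (t - p) (by omega)
    have h2 := hd (t - p) (by omega)
    rw [show t - p + p = t by omega] at h1
    rw [← h1, h2]
    congr 1
    omega
  · have h1 := hd t (by omega)
    have h2 := hp (t + (d - p)) (by omega)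
    rw [h1, h2]
    congr 1
    omega

/-- The weak form of the theorem of Fine and Wilf, for the least period. -/
theorem HasPeriod.dvd {β : Type*} {W : ℕ → β} {m p : ℕ} (hp0 : 0 < p) (hp : HasPeriod W m p)
    (hmin : ∀ e, 0 < e → HasPeriod W m e → p ≤ e) (d : ℕ) (hd : HasPeriod W m d)
    (h : p + d ≤ m) : p ∣ d := by
  induction d using Nat.strong_induction_on with
  | _ d ih =>
    rcases Nat.eq_zero_or_pos d with rfl | hd0
    · exact dvd_zero p
    · have hle := hmin d hd0 hd
      have := ih (d - p) (by omega) (hp.sub hd hle h) (by omega)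
      exact (Nat.dvd_sub_iff_left hle dvd_rfl).1 this

theorem IsBorder.hasPeriod {β : Type*} {W : ℕ → β} {m s : ℕ} (h : IsBorder W m s) :
    HasPeriod W m (m - s) := by
  intro t ht
  rw [h.2.2 t (by omega), add_comm]

theorem IsBorder.trans_le {β : Type*} {W : ℕ → β} {m s r : ℕ} (hs : IsBorder W m s)
    (hr : IsBorder W m r) (hrs : r ≤ s) : IsBorder W s r := by
  refine ⟨hr.1, hrs, fun t ht => ?_⟩
  rw [hr.2.2 t ht, hs.2.2 (s - r + t) (by have := hr.1; omega)]
  congr 1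
  have := hs.2.1
  omega

/-- For k ≥ 3 this is the monotonicity of log x / x beyond e. For k ≤ 2 it follows from q < 2 ^ q,
and the factor 2 bounds k. -/
theorem mul_log_le_two_mul_log_max {q k : ℕ} (hk : 1 ≤ k) (hkq : k < q) :
    (k : ℝ) * Real.log q ≤ 2 * q * Real.log (max k 2 : ℕ) := by
  have hq : (0 : ℝ) < q := by exact_mod_cast (by omega : 0 < q)
  have hlq : 0 ≤ Real.log q := Real.log_natCast_nonneg q
  rcases le_or_gt k 2 with h | h
  · rw [max_eq_right h]
    have h2 : Real.log q ≤ q * Real.log 2 := by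
      rw [← Real.log_pow]
      exact Real.log_le_log hq (by exact_mod_cast Nat.lt_two_pow_self.le)
    have : (k : ℝ) ≤ 2 := by exact_mod_cast h
    push_cast
    nlinarith
  · rw [max_eq_left h.le]
    have h3 : Real.exp 1 ≤ (k : ℝ) := by
      have : (3 : ℝ) ≤ k := by exact_mod_cast h
      linarith [Real.exp_one_lt_d9]
    have hkq' : (k : ℝ) ≤ q := by exact_mod_cast hkq.le
    have := Real.log_div_self_antitoneOn h3 (h3.trans hkq') hkq'
    have hk0 : (0 : ℝ) < k := by exact_mod_cast hk
    have hlk : 0 ≤ Real.log k := Real.log_natCast_nonneg k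
    simp only at this
    rw [div_le_div_iff₀ hq hk0] at this
    nlinarith

theorem le_two_mul_logb_max {q k : ℕ} (hk : 1 ≤ k) (hkq : k < q) :
    (k : ℝ) ≤ 2 * q * Real.logb q (max k 2 : ℕ) := by
  have hlq : 0 < Real.log q := Real.log_pos (by exact_mod_cast (by omega : 1 < q))
  rw [Real.logb, mul_div_assoc', le_div_iff₀ hlq]
  exact mul_log_le_two_mul_log_max hk hkq

/-- Let p be the least period and k = m / p < q. At most k borders have length at least p; the
shorter ones are borders of the longest among them, of length m', and induction applies. The cost k
is paid by the drop in logarithm, because max(k, 2) · m' ≤ m. Periods of all prefixes are restricted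
in `hW` since the recursion passes to a prefix. -/
theorem card_borders_le {β : Type*} (W : ℕ → β) {q : ℕ} (hq : 2 ≤ q) (m : ℕ) (hm : 1 ≤ m)
    (hW : ∀ M ≤ m, ∀ p, 0 < p → HasPeriod W M p → M < q * p) (A : Finset ℕ)
    (hA : ∀ s ∈ A, IsBorder W m s) : (A.card : ℝ) ≤ 2 * q * Real.logb q m + 1 := by
  have hq1 : (1 : ℝ) < q := by exact_mod_cast (by omega : 1 < q)
  induction m using Nat.strong_induction_on generalizing A with
  | _ m ih =>
  classical
  obtain ⟨p, ⟨hp0, hp⟩, hmin⟩ : ∃ p, (0 < p ∧ HasPeriod W m p) ∧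
      ∀ e, 0 < e → HasPeriod W m e → p ≤ e := by
    have hex : ∃ p, 0 < p ∧ HasPeriod W m p := ⟨m, hm, fun t ht => by omega⟩
    exact ⟨Nat.find hex, Nat.find_spec hex, fun e h1 h2 => Nat.find_min' hex ⟨h1, h2⟩⟩
  have hpm : p ≤ m := hmin m hm (fun t ht => by omega)
  obtain ⟨k, hk⟩ : ∃ k, k = m / p := ⟨_, rfl⟩
  have hk1 : 1 ≤ k := by rw [hk]; exact (Nat.one_le_div_iff hp0).2 hpm
  have hkp : k * p ≤ m := by rw [hk]; exact Nat.div_mul_le_self m p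
  have hkq : k < q := by
    rw [hk]; exact Nat.div_lt_of_lt_mul (by rw [mul_comm]; exact hW m le_rfl p hp0 hp)
  have hlong : (A.filter (fun s => p ≤ s)).card ≤ k := by
    -- A border of length s gives the period m - s; the condition p ≤ s is what lets Fine and Wilf
    -- conclude that p divides it.
    have : A.filter (fun s => p ≤ s) ⊆ (Finset.range k).image (fun j => m - j * p) := by
      intro s hs
      rw [Finset.mem_filter] at hs
      have hb := hA s hs.1
      have h1 := hb.2.1
      obtain ⟨j, hj⟩ := hp.dvd hp0 hmin (m - s) hb.hasPeriod (by omega)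
      rw [Finset.mem_image]
      refine ⟨j, Finset.mem_range.2 ?_, ?_⟩
      · rw [hk, Nat.lt_iff_add_one_le, Nat.le_div_iff_mul_le hp0]
        have : (j + 1) * p = p * j + p := by ring
        omega
      · rw [mul_comm, ← hj]
        omega
    exact (Finset.card_le_card this).trans (Finset.card_image_le.trans (by simp))
  have hsplit : A.card = (A.filter (fun s => p ≤ s)).card +
      (A.filter (fun s => ¬ p ≤ s)).card := (Finset.card_filter_add_card_filter_not _).symm
  have hkR := le_two_mul_logb_max hk1 hkq
  rcases (A.filter (fun s => ¬ p ≤ s)).eq_empty_or_nonempty with hE | hE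
  · rw [hE, Finset.card_empty, add_zero] at hsplit
    rcases eq_or_lt_of_le hk1 with h1 | h1
    · have : (A.card : ℝ) ≤ 1 := by exact_mod_cast (by omega : A.card ≤ 1)
      have h2 : 0 ≤ Real.logb q m := Real.logb_nonneg hq1 (by exact_mod_cast hm)
      nlinarith
    · rw [max_eq_left (by omega)] at hkR
      have hkm : k ≤ m := le_trans (Nat.le_mul_of_pos_right k hp0) hkp
      have h2 : Real.logb q k ≤ Real.logb q m :=
        Real.logb_le_logb_of_le hq1 (by exact_mod_cast hk1) (by exact_mod_cast hkm)
      have : (A.card : ℝ) ≤ k := by exact_mod_cast (by omega : A.card ≤ k)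
      nlinarith
  · obtain ⟨m', hm', hmax⟩ := Finset.exists_max_image _ id hE
    simp only [id] at hmax
    have hm'A := Finset.mem_filter.1 hm'
    have hb := hA m' hm'A.1
    have hm'0 := hb.1
    have hm'm := hb.2.1
    -- For k ≤ 2 the factor 2 comes from m' < p ≤ m - m', as m - m' is itself a period; for larger
    -- k, from m' < p and kp ≤ m.
    have hKm : max k 2 * m' ≤ m := by
      rcases le_or_gt k 2 with h | h
      · rw [max_eq_right h]
        have := hmin (m - m') (by omega) hb.hasPeriod
        omega
      · rw [max_eq_left h.le]
        exact le_trans (Nat.mul_le_mul_left k (by omega)) hkp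
    have hrec := ih m' (by omega) hm'0 (fun M hM => hW M (hM.trans hm'm)) (A.filter (fun s => ¬ p ≤ s)) (fun s hs =>
      hb.trans_le (hA s (Finset.mem_filter.1 hs).1) (hmax s hs))
    have hlog : Real.logb q (max k 2 : ℕ) + Real.logb q m' ≤ Real.logb q m := by
      rw [← Real.logb_mul (by positivity) (by positivity)]
      exact Real.logb_le_logb_of_le hq1 (by positivity) (by exact_mod_cast hKm)
    have : (A.card : ℝ) ≤ k + ((A.filter (fun s => ¬ p ≤ s)).card : ℝ) := by
      exact_mod_cast (by omega : A.card ≤ k + (A.filter (fun s => ¬ p ≤ s)).card)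
    nlinarith

/-! ### Windows of `$S$`, and periods as powers -/

variable {α : Type*}

/-- The string `S[k..k+L-1]`, with end markers outside of `S`. -/
def window (S : List α) (k L : ℕ) : List (Option α) :=
  (List.range L).map (fun i => charAt S (k + i))

theorem window_eq_iff {S : List α} {k k' L : ℕ} :
    window S k L = window S k' L ↔ ∀ i < L, charAt S (k + i) = charAt S (k' + i) := by
  simp [window]

theorem window_succ (S : List α) (k L : ℕ) :
    window S k (L + 1) = window S k L ++ [charAt S (k + L)] := by
  simp [window, List.range_succ]

theorem length_window (S : List α) (k L : ℕ) : (window S k L).length = L := by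
  simp [window]

theorem charAt_succ (S : List α) (i : ℕ) : charAt S (i + 1) = S[i]? := by
  simp [charAt]

theorem charAt_pos {S : List α} {i : ℕ} (hi : 1 ≤ i) : charAt S i = S[i - 1]? := by
  rw [charAt, if_neg (by omega)]

theorem charAt_eq_none {S : List α} {i : ℕ} : charAt S i = none ↔ i = 0 ∨ S.length < i := by
  rcases i with _ | i
  · simp [charAt]
  · rw [charAt_succ, List.getElem?_eq_none_iff]
    omega

theorem length_terminated (S : List α) : (terminated S).length = S.length + 1 := by
  simp [terminated]

theorem getElem?_terminated {S : List α} {i : ℕ} (hi : i ≤ S.length) :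
    (terminated S)[i]? = some (charAt S (i + 1)) := by
  rw [terminated, charAt_succ]
  rcases hi.lt_or_eq with h | rfl
  · rw [List.getElem?_append_left (by simpa using h)]
    simp [h]
  · rw [List.getElem?_append_right (by simp)]
    simp

theorem eq_window_of_terminated_eq {S : List α} {u x v : List (Option α)}
    (h : terminated S = u ++ x ++ v) : x = window S (u.length + 1) x.length := by
  have hl : S.length + 1 = u.length + x.length + v.length := by
    rw [← length_terminated, h]; simp; omega
  apply List.ext_getElem?
  intro i
  rcases lt_or_ge i x.length with hi | hi
  · have h1 := getElem?_terminated (S := S) (i := u.length + i) (by omega)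
    rw [h, List.append_assoc, List.getElem?_append_right (by omega), Nat.add_sub_cancel_left,
      List.getElem?_append_left hi] at h1
    rw [h1]
    simp [window, hi, add_right_comm]
  · rw [List.getElem?_eq_none hi, List.getElem?_eq_none (by rw [length_window]; exact hi)]

theorem terminated_eq_window (S : List α) : terminated S = window S 1 (S.length + 1) := by
  have := eq_window_of_terminated_eq (S := S) (u := []) (x := terminated S) (v := []) (by simp)
  rwa [length_terminated] at this

theorem window_add (S : List α) (k L M : ℕ) :
    window S k (L + M) = window S k L ++ window S (k + L) M := by
  induction M with
  | zero => simp [window]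
  | succ M ih => rw [← add_assoc, window_succ, ih, window_succ, List.append_assoc, add_assoc]

/-- The windows inside of `S$` are the substrings of `S$`. -/
theorem infix_terminated_iff {S : List α} {x : List (Option α)} :
    x <:+: terminated S ↔ ∃ k, 1 ≤ k ∧ k + x.length ≤ S.length + 2 ∧ x = window S k x.length := by
  constructor
  · rintro ⟨u, v, h⟩
    have hl : S.length + 1 = u.length + x.length + v.length := by
      rw [← length_terminated, ← h]; simp; omega
    exact ⟨u.length + 1, by omega, by omega, eq_window_of_terminated_eq h.symm⟩
  · rintro ⟨k, h1, h2, h3⟩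
    refine ⟨window S 1 (k - 1), window S (k + x.length) (S.length + 2 - (k + x.length)), ?_⟩
    rw [h3, length_window, terminated_eq_window]
    conv_lhs => enter [1, 2]; rw [show k = 1 + (k - 1) by omega]
    rw [← window_add]
    conv_lhs => enter [2]; rw [show k + x.length = 1 + (k - 1 + x.length) by omega]
    rw [← window_add]
    congr 1
    omega

theorem map_some_take_drop {S : List α} {n l : ℕ} (hn : 1 ≤ n) (h : n + l ≤ S.length + 1) :
    ((S.drop (n - 1)).take l).map some = window S n l := by
  apply List.ext_getElem
  · simp [length_window]; omega
  · intro i h1 h2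
    rw [length_window] at h2
    simp only [List.getElem_map, List.getElem_take, List.getElem_drop, window, List.getElem_range]
    rw [charAt_pos (by omega), show n + i - 1 = n - 1 + i by omega, List.getElem?_eq_getElem]

theorem take_mul_eq_flatten (L : List α) (p : ℕ) (j : ℕ)
    (h : ∀ i, i + p < j * p → L[i]? = L[i + p]?) :
    L.take (j * p) = (List.replicate j (L.take p)).flatten := by
  have aux : ∀ a i, a * p + i < j * p → L[a * p + i]? = L[i]? := by
    intro a
    induction a with
    | zero => simp
    | succ a ih =>
      intro i hi
      have e : (a + 1) * p + i = a * p + i + p := by ring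
      rw [e] at hi ⊢
      rw [← h _ hi, ih i (by omega)]
  clear h
  induction j with
  | zero => simp
  | succ j ih =>
    rw [List.replicate_succ', List.flatten_append, ← ih (fun a i hi => aux a i (by
      rw [Nat.succ_mul]; omega)), Nat.succ_mul, List.take_add]
    congr 1
    simp only [List.flatten_cons, List.flatten_nil, List.append_nil]
    apply List.ext_getElem?
    intro i
    rcases lt_or_ge i p with hi | hi
    · rw [List.getElem?_take_of_lt hi, List.getElem?_take_of_lt hi, List.getElem?_drop]
      exact aux j i (by rw [Nat.succ_mul]; omega)
    · rw [List.getElem?_take_eq_none hi, List.getElem?_take_eq_none hi]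

/-- Otherwise the first qp characters of the window would be the q-th power of its prefix of length
p. -/
theorem lt_mul_of_hasPeriod {S : List α} {q : ℕ} (hq0 : 0 < q) (hq : ¬ ContainsPower q S) {a M p : ℕ}
    (ha : 1 ≤ a) (haM : a + M ≤ S.length + 1) (hp : 0 < p)
    (h : HasPeriod (fun t => charAt S (a + t)) M p) : M < q * p := by
  by_contra hcon
  push Not at hcon
  have hqp : 0 < q * p := Nat.mul_pos hq0 hp
  have key := take_mul_eq_flatten (S.drop (a - 1)) p q (by
    intro i hi
    have := h i (by omega)
    simp only [charAt_pos (show 1 ≤ a + i by omega),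
      charAt_pos (show 1 ≤ a + (i + p) by omega)] at this
    rw [List.getElem?_drop, List.getElem?_drop]
    rwa [show a - 1 + i = a + i - 1 by omega, show a - 1 + (i + p) = a + (i + p) - 1 by omega])
  refine hq ⟨(S.drop (a - 1)).take p, ?_, ?_⟩
  · apply List.ne_nil_of_length_pos
    rw [List.length_take, List.length_drop]
    omega
  · rw [← key]
    exact (List.take_prefix _ _).isInfix.trans (List.drop_suffix _ _).isInfix

theorem two_le_of_not_containsPower {S : List α} (hS : S ≠ []) {q : ℕ}
    (hq : ¬ ContainsPower q S) : 2 ≤ q := by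
  by_contra h
  apply hq
  refine ⟨S, hS, ?_⟩
  interval_cases q
  · simp
  · simp

/-! ### Boundaries of the factorization and leftmost occurrences -/

/-- The position (counted from `1`) of the first character after the first `i` factors. -/
def boundary (F : List (List α)) (i : ℕ) : ℕ := (F.take i).flatten.length + 1

/-- The positions after the factors, and the first position. -/
def boundaries (F : List (List α)) : Finset ℕ := (Finset.range (F.length + 1)).image (boundary F)

theorem card_boundaries_le (F : List (List α)) : (boundaries F).card ≤ F.length + 1 :=
  Finset.card_image_le.trans (by simp)

theorem boundary_succ {F : List (List α)} {i : ℕ} (hi : i < F.length) :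
    boundary F (i + 1) = boundary F i + F[i].length := by
  simp only [boundary, List.take_succ_eq_append_getElem hi, List.flatten_append,
    List.length_append, List.flatten_cons, List.flatten_nil, List.append_nil]
  omega

theorem boundary_mem {F : List (List α)} {i : ℕ} (hi : i ≤ F.length) :
    boundary F i ∈ boundaries F :=
  Finset.mem_image_of_mem _ (Finset.mem_range.2 (by omega))

theorem boundary_zero (F : List (List α)) : boundary F 0 = 1 := by simp [boundary]

theorem boundary_length {S : List α} {F : List (List α)} (hF : F.flatten = S) :
    boundary F F.length = S.length + 1 := by simp [boundary, hF]

theorem exists_boundary_le_lt {S : List α} {F : List (List α)} (hF : F.flatten = S) {k : ℕ}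
    (hk : 1 ≤ k) (hk' : k ≤ S.length) :
    ∃ i < F.length, boundary F i ≤ k ∧ k < boundary F (i + 1) := by
  have hex : ∃ i, k < boundary F i := ⟨F.length, by rw [boundary_length hF]; omega⟩
  have h1 := Nat.find_spec hex
  have h2 : Nat.find hex ≤ F.length := Nat.find_min' hex (by rw [boundary_length hF]; omega)
  have h3 : Nat.find hex ≠ 0 := by
    intro h0
    rw [h0, boundary_zero] at h1
    omega
  refine ⟨Nat.find hex - 1, by omega, ?_, ?_⟩
  · exact not_lt.1 (Nat.find_min hex (m := Nat.find hex - 1) (by omega))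
  · rwa [Nat.sub_add_cancel (by omega)]

theorem charAt_of_eq_append {S a u b : List α} (h : S = a ++ u ++ b) {i : ℕ} (hi : i < u.length) :
    charAt S (a.length + 1 + i) = u[i]? := by
  rw [add_right_comm, charAt_succ, h, List.append_assoc, List.getElem?_append_right (by omega),
    Nat.add_sub_cancel_left, List.getElem?_append_left hi]

/-- A window inside of a factor is a single character, or it has an occurrence further left. -/
theorem exists_lt_window_eq {S : List α} {F : List (List α)} (hF : IsLZ77 S F) {i k L : ℕ}
    (hi : i < F.length) (hk : boundary F i ≤ k) (hL : 1 ≤ L) (hkL : k + L ≤ boundary F (i + 1)) :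
    (L = 1 ∧ k = boundary F i) ∨ ∃ k' < k, 1 ≤ k' ∧ window S k' L = window S k L := by
  obtain ⟨hS, hF⟩ := hF
  rw [boundary_succ hi] at hkL
  rcases hF i hi with ⟨c, hc, -⟩ | ⟨-, hocc, -⟩
  · left
    rw [hc] at hkL
    simp only [List.length_cons, List.length_nil] at hkL
    omega
  · right
    -- The factor is a suffix of the string in which it occurs twice, so its other occurrence starts
    -- further left.
    obtain ⟨p, ⟨a, b, hab, hap⟩, hpne⟩ := hocc.exists_ne (F.take i).flatten.length
    have hlen := congrArg List.length hab
    simp only [List.length_append] at hlen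
    have hS' : S = (F.take i).flatten ++ F[i] ++ (F.drop (i + 1)).flatten := by
      rw [← hS]
      rw [List.append_assoc, ← List.flatten_cons, ← List.drop_eq_getElem_cons hi,
        ← List.flatten_append, List.take_append_drop]
    have hS'' : S = a ++ F[i] ++ (b ++ (F.drop (i + 1)).flatten) := by
      conv_lhs => rw [hS', hab]
      simp
    have hba : boundary F i = (F.take i).flatten.length + 1 := rfl
    refine ⟨a.length + 1 + (k - boundary F i), by omega, by omega, ?_⟩
    rw [window_eq_iff]
    intro t ht
    have h1 := charAt_of_eq_append hS'' (i := k - boundary F i + t) (by omega)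
    have h2 := charAt_of_eq_append hS' (i := k - boundary F i + t) (by omega)
    rw [add_assoc, h1, ← h2]
    congr 1
    omega

/-- A leftmost occurrence of a string of length at least two in `$S$` straddles a boundary. -/
theorem exists_boundary_straddled {S : List α} {F : List (List α)} (hF : IsLZ77 S F) {k L : ℕ}
    (hL : 2 ≤ L) (hkL : k + L ≤ S.length + 2)
    (hmin : ∀ k' < k, window S k' L ≠ window S k L) :
    ∃ b ∈ boundaries F, k < b ∧ b < k + L := by
  by_contra! hcon
  -- The boundaries 1 and |S| + 1 exclude windows that contain an end marker, so the window lies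
  -- inside S.
  have h0 := hcon _ (boundary_mem (Nat.zero_le _))
  have hz := hcon _ (boundary_mem le_rfl)
  rw [boundary_zero] at h0
  rw [boundary_length hF.1] at hz
  obtain ⟨i, hi, h1, h2⟩ := exists_boundary_le_lt hF.1 (k := k) (by omega) (by omega)
  have h3 := hcon _ (boundary_mem (F := F) (i := i + 1) hi) h2
  rcases exists_lt_window_eq hF hi h1 (by omega) h3 with ⟨h, -⟩ | ⟨k', hk', -, h⟩
  · omega
  · exact hmin k' hk' h

/-- Every character of `S$` occurs at a boundary. -/
theorem exists_boundary_charAt_eq {S : List α} {F : List (List α)} (hF : IsLZ77 S F) {k : ℕ}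
    (hk : 1 ≤ k) (hk' : k ≤ S.length + 1) : ∃ b ∈ boundaries F, charAt S b = charAt S k := by
  induction k using Nat.strong_induction_on with
  | _ k ih =>
  rcases hk'.lt_or_eq with h | rfl
  · obtain ⟨i, hi, h1, h2⟩ := exists_boundary_le_lt hF.1 hk (by omega)
    rcases exists_lt_window_eq hF hi h1 le_rfl h2 with ⟨-, h⟩ | ⟨k', hk', h1', h⟩
    · exact ⟨_, boundary_mem hi.le, by rw [h]⟩
    · obtain ⟨b, hb, hb'⟩ := ih k' hk' h1' (by omega)
      refine ⟨b, hb, hb'.trans ?_⟩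
      simpa using window_eq_iff.1 h 0 (by omega)
  · exact ⟨_, boundary_mem le_rfl, by rw [boundary_length hF.1]⟩

theorem exists_leftmost_window (S : List α) (k L : ℕ) :
    ∃ k' ≤ k, window S k' L = window S k L ∧ ∀ j < k', window S j L ≠ window S k' L := by
  classical
  have hex : ∃ k', window S k' L = window S k L := ⟨k, rfl⟩
  refine ⟨Nat.find hex, Nat.find_min' hex rfl, Nat.find_spec hex, fun j hj h => ?_⟩
  exact Nat.find_min hex hj (h.trans (Nat.find_spec hex))

/-! ### Moving maximal pairs to the boundaries -/

/-- `k` is the position in `S` of an occurrence of the window of length `l` at `n`. -/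
def IsOcc (S : List α) (n l k : ℕ) : Prop :=
  1 ≤ k ∧ k + l ≤ S.length + 1 ∧ window S k l = window S n l

theorem IsOcc.isMaximalPair {S : List α} {n l k k' : ℕ} (hl : 1 ≤ l) (hk : IsOcc S n l k)
    (hk' : IsOcc S n l k') (hleft : charAt S (k - 1) ≠ charAt S (k' - 1))
    (hright : charAt S (k + l) ≠ charAt S (k' + l)) : IsMaximalPair S k k' l :=
  ⟨hl, hk.1, hk'.1, hk.2.1, hk'.2.1, window_eq_iff.1 (hk.2.2.trans hk'.2.2.symm), hleft, hright⟩

/-- The closed range of gaps from `k` to `k + l` contains a boundary. -/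
def Touches (F : List (List α)) (k l : ℕ) : Prop := ∃ b ∈ boundaries F, k ≤ b ∧ b ≤ k + l

/-- The leftmost occurrence of the string together with its right neighbour straddles a boundary;
dropping the last character turns straddling into touching. -/
theorem IsOcc.exists_touches_right {S : List α} {F : List (List α)} (hF : IsLZ77 S F)
    {n l k : ℕ} (hl : 1 ≤ l) (hk : IsOcc S n l k) :
    ∃ k', IsOcc S n l k' ∧ Touches F k' l ∧ charAt S (k' + l) = charAt S (k + l) := by
  obtain ⟨h1, h2, h3⟩ := hk
  obtain ⟨k', hle, heq, hmin⟩ := exists_leftmost_window S k (l + 1)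
  obtain ⟨b, hb, hb1, hb2⟩ := exists_boundary_straddled hF (by omega) (by omega) hmin
  rw [window_eq_iff] at heq
  -- A window at 0 starts with the end marker, whereas the one at k starts inside S.
  have hk'0 : 1 ≤ k' := by
    by_contra h
    obtain rfl : k' = 0 := by omega
    have := heq 0 (by omega)
    have := charAt_eq_none.1 (this.symm.trans (by simp [charAt]))
    omega
  refine ⟨k', ⟨hk'0, by omega, ?_⟩, ⟨b, hb, by omega, by omega⟩, heq l (by omega)⟩
  rw [← h3, window_eq_iff]
  exact fun i hi => heq i (by omega)

theorem IsOcc.exists_touches_left {S : List α} {F : List (List α)} (hF : IsLZ77 S F)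
    {n l k : ℕ} (hl : 1 ≤ l) (hk : IsOcc S n l k) :
    ∃ k', IsOcc S n l k' ∧ Touches F k' l ∧ charAt S (k' - 1) = charAt S (k - 1) := by
  obtain ⟨h1, h2, h3⟩ := hk
  obtain ⟨k', hle, heq, hmin⟩ := exists_leftmost_window S (k - 1) (l + 1)
  obtain ⟨b, hb, hb1, hb2⟩ := exists_boundary_straddled hF (by omega) (by omega) hmin
  rw [window_eq_iff] at heq
  refine ⟨k' + 1, ⟨by omega, by omega, ?_⟩, ⟨b, hb, by omega, by omega⟩, heq 0 (by omega)⟩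
  rw [← h3, window_eq_iff]
  intro i hi
  have := heq (i + 1) (by omega)
  rw [show k' + 1 + i = k' + (i + 1) by omega, this]
  congr 1
  omega

/-- Combines separate left and right mismatches into one pair that mismatches on both sides, with a
prescribed value of `g`. Three elements suffice: `k₁` with the prescribed `g`, `k₂` differing from
`k₁` in `f`, and `k₃` with another `g`; some two of them differ in both. -/
theorem exists_ne_ne {ι β γ : Type*} {P Q : ι → Prop} {f : ι → β} {g : ι → γ}
    (hf : ∀ k, P k → ∃ k', P k' ∧ Q k' ∧ f k' = f k)
    (hg : ∀ k, P k → ∃ k', P k' ∧ Q k' ∧ g k' = g k)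
    {i j i' j' k : ι} (hi : P i) (hj : P j) (hij : f i ≠ f j) (hi' : P i') (hj' : P j')
    (hij' : g i' ≠ g j') (hk : P k) :
    ∃ a b, P a ∧ Q a ∧ P b ∧ Q b ∧ f a ≠ f b ∧ g a ≠ g b ∧ (g a = g k) := by
  obtain ⟨k₁, h1, h1', h1''⟩ := hg k hk
  obtain ⟨r, hr, hrne⟩ : ∃ r, P r ∧ f r ≠ f k₁ := by
    by_cases h : f i = f k₁
    · exact ⟨j, hj, fun h' => hij (h.trans h'.symm)⟩
    · exact ⟨i, hi, h⟩
  obtain ⟨r', hr', hrne'⟩ : ∃ r, P r ∧ g r ≠ g k := by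
    by_cases h : g i' = g k
    · exact ⟨j', hj', fun h' => hij' (h.trans h'.symm)⟩
    · exact ⟨i', hi', h⟩
  obtain ⟨k₂, h2, h2', h2''⟩ := hf r hr
  obtain ⟨k₃, h3, h3', h3''⟩ := hg r' hr'
  rw [← h2''] at hrne
  rw [← h3''] at hrne'
  by_cases h : g k₂ = g k
  · by_cases h' : f k₁ = f k₃
    · exact ⟨k₂, k₃, h2, h2', h3, h3', h' ▸ hrne, h ▸ hrne'.symm, h⟩
    · exact ⟨k₁, k₃, h1, h1', h3, h3', h', h1'' ▸ hrne'.symm, h1''⟩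
  · exact ⟨k₁, k₂, h1, h1', h2, h2', hrne.symm, h1'' ▸ fun h' => h h'.symm, h1''⟩

theorem exists_maximalPair_of_mem_rightExtensions {S : List α} {F : List (List α)}
    (hF : IsLZ77 S F) {R : List (Option α)} (hR : R ∈ rightExtensions S) :
    ∃ n m l, IsMaximalPair S n m l ∧ Touches F n l ∧ Touches F m l ∧ R = window S n (l + 1) := by
  obtain ⟨P, c, ⟨n, m, l, hp, hP⟩, hRP, hinf⟩ := hR
  have hPw : P.map some = window S n l := by rw [hP, map_some_take_drop hp.one_le_n hp.n_le]
  rw [hPw] at hRP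
  have hRl : R.length = l + 1 := by rw [hRP]; simp [length_window]
  obtain ⟨k, hk1, hk2, hk3⟩ := infix_terminated_iff.1 hinf
  rw [hRl] at hk2 hk3
  rw [hk3, window_succ] at hRP
  obtain ⟨hkw, hc⟩ := List.append_inj' hRP rfl
  have hl := hp.one_le_l
  have hnocc : IsOcc S n l n := ⟨hp.one_le_n, hp.n_le, rfl⟩
  have hmocc : IsOcc S n l m := ⟨hp.one_le_m, hp.m_le, (window_eq_iff.2 hp.eq).symm⟩
  have hkocc : IsOcc S n l k := ⟨hk1, by omega, hkw⟩
  obtain ⟨a, b, ha, ha', hb, hb', h1, h2, h3⟩ := exists_ne_ne (P := IsOcc S n l)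
    (Q := fun k => Touches F k l) (f := fun k => charAt S (k - 1)) (g := fun k => charAt S (k + l))
    (fun k hk => hk.exists_touches_left hF hl) (fun k hk => hk.exists_touches_right hF hl)
    hnocc hmocc hp.left_ne hnocc hmocc hp.right_ne hkocc
  refine ⟨a, b, l, ha.isMaximalPair hl hb h1 h2, ha', hb', ?_⟩
  rw [hk3, window_succ, window_succ, hkw, ha.2.2, h3]

/-- A maximal pair that touches `b` and `b'` is determined by `b`, `b'` and its shift. -/
theorem IsMaximalPair.unique {S : List α} {n m l n' m' l' b b' : ℕ} (h : IsMaximalPair S n m l)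
    (h' : IsMaximalPair S n' m' l') (hb : n ≤ b) (hb2 : b ≤ n + l) (hc : n' ≤ b)
    (hc2 : b ≤ n' + l') (hm : m ≤ b') (hm' : m' ≤ b')
    (hs : ((b : ℤ) - n) - (b' - m) = (b - n') - (b' - m')) : n = n' ∧ l = l' := by
  wlog hle : n ≤ n' generalizing n m l n' m' l'
  · obtain ⟨h1, h2⟩ := this h' h hc hc2 hb hb2 hm' hm hs.symm (by omega)
    exact ⟨h1.symm, h2.symm⟩
  have hl := h.one_le_l
  have hl' := h'.one_le_l
  have hnn : n = n' := by
    by_contra hne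
    -- Equal shifts align both pairs. If n < n', the character before n' lies in the first pair,
    -- where both sides agree, against left maximality; a gap between the two is impossible as both
    -- touch b.
    by_cases hend : n' - 1 < n + l
    · apply h'.left_ne
      have := h.eq (n' - 1 - n) (by omega)
      rwa [show n + (n' - 1 - n) = n' - 1 by omega,
        show m + (n' - 1 - n) = m' - 1 by omega] at this
    · omega
  subst hnn
  obtain rfl : m = m' := by omega
  refine ⟨rfl, ?_⟩
  rcases lt_trichotomy l l' with hlt | heq | hlt
  · exact absurd (h'.eq l hlt) h.right_ne
  · exact heq
  · exact absurd (h.eq l' hlt) h'.right_ne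

theorem IsMaximalPair.swap {S : List α} {n m l : ℕ} (h : IsMaximalPair S n m l) :
    IsMaximalPair S m n l :=
  ⟨h.1, h.3, h.2, h.5, h.4, fun i hi => (h.6 i hi).symm, h.7.symm, h.8.symm⟩

/-! ### Counting the shifts -/

/-- The string of length `s` that ends before `b` is the one that starts at `b'`. -/
def IsOverlap (S : List α) (b b' s : ℕ) : Prop :=
  1 ≤ s ∧ s < b ∧ b ≤ S.length + 1 ∧ 1 ≤ b' ∧ b' + s ≤ S.length + 1 ∧
    window S (b - s) s = window S b' s

/-- The position in the first occurrence that corresponds to b' is b - s, where s is the shift. -/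
theorem IsMaximalPair.isOverlap {S : List α} {n m l b b' : ℕ} (h : IsMaximalPair S n m l)
    (hb : n ≤ b) (hb2 : b ≤ n + l) (hm : m ≤ b') (hs : b' - m < b - n) :
    IsOverlap S b b' ((b - n) - (b' - m)) := by
  have h2 := h.one_le_n
  have h3 := h.one_le_m
  have h4 := h.n_le
  have h5 := h.m_le
  refine ⟨by omega, by omega, by omega, by omega, by omega, ?_⟩
  rw [window_eq_iff]
  intro i hi
  have := h.eq (b' - m + i) (by omega)
  rw [show b - (b - n - (b' - m)) + i = n + (b' - m + i) by omega, this]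
  congr 1
  omega

open Classical in
/-- The set of the lengths of the overlaps. -/
noncomputable def overlaps (S : List α) (b b' : ℕ) : Finset ℕ :=
  (Finset.range (S.length + 1)).filter (IsOverlap S b b')

theorem mem_overlaps {S : List α} {b b' s : ℕ} : s ∈ overlaps S b b' ↔ IsOverlap S b b' s := by
  classical
  rw [overlaps, Finset.mem_filter, Finset.mem_range, and_iff_right_iff_imp]
  intro h
  have := h.2.1
  have := h.2.2.1
  omega

/-- With m the longest overlap, the string of length m at b' has every other overlap as a prefix,
since it starts at b', and as a suffix, since it ends before b. -/
theorem card_overlaps_le {S : List α} (hS : S ≠ []) {q : ℕ} (hq : ¬ ContainsPower q S) (b b' : ℕ) :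
    ((overlaps S b b').card : ℝ) ≤ 2 * q * Real.logb q S.length + 1 := by
  have hq2 := two_le_of_not_containsPower hS hq
  have hq1 : (1 : ℝ) < q := by exact_mod_cast (by omega : 1 < q)
  have hS1 : 1 ≤ S.length := List.length_pos_iff.2 hS
  rcases (overlaps S b b').eq_empty_or_nonempty with hE | hE
  · rw [hE, Finset.card_empty, Nat.cast_zero]
    have : 0 ≤ Real.logb q S.length := Real.logb_nonneg hq1 (by exact_mod_cast hS1)
    positivity
  · obtain ⟨m, hm, hmax⟩ := Finset.exists_max_image _ id hE
    simp only [id] at hmax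
    obtain ⟨h1, h2, h3, h4, h5, h6⟩ := mem_overlaps.1 hm
    have key := card_borders_le (fun t => charAt S (b' + t)) hq2 m h1
      (fun M hM p hp h => lt_mul_of_hasPeriod (by omega) hq h4 (by omega) hp h)
      (overlaps S b b') (by
        intro s hs
        have hsm := hmax s hs
        obtain ⟨g1, g2, g3, g4, g5, g6⟩ := mem_overlaps.1 hs
        refine ⟨g1, hsm, fun t ht => ?_⟩
        have e1 := window_eq_iff.1 g6 t ht
        have e2 := window_eq_iff.1 h6 (m - s + t) (by omega)
        rw [show b - m + (m - s + t) = b - s + t by omega] at e2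
        exact e1.symm.trans e2)
    have : Real.logb q m ≤ Real.logb q S.length :=
      Real.logb_le_logb_of_le hq1 (by exact_mod_cast h1) (by exact_mod_cast (by omega))
    nlinarith

/-- The possible shifts of the maximal pairs that touch `b` and `b'`. -/
noncomputable def shifts (S : List α) (b b' : ℕ) : Finset ℤ :=
  insert 0 ((overlaps S b b').image (fun s : ℕ => (s : ℤ)) ∪
    (overlaps S b' b).image (fun s : ℕ => -(s : ℤ)))

theorem card_shifts_le {S : List α} (hS : S ≠ []) {q : ℕ} (hq : ¬ ContainsPower q S) (b b' : ℕ) :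
    ((shifts S b b').card : ℝ) ≤ 4 * q * Real.logb q S.length + 3 := by
  have h1 : (shifts S b b').card ≤ (overlaps S b b').card + (overlaps S b' b).card + 1 :=
    (Finset.card_insert_le _ _).trans (Nat.add_le_add_right ((Finset.card_union_le _ _).trans
      (Nat.add_le_add Finset.card_image_le Finset.card_image_le)) 1)
  have h2 := card_overlaps_le hS hq b b'
  have h3 := card_overlaps_le hS hq b' b
  have h4 : ((shifts S b b').card : ℝ) ≤ (overlaps S b b').card + (overlaps S b' b).card + 1 := by
    exact_mod_cast h1
  linarith

theorem IsMaximalPair.shift_mem {S : List α} {n m l b b' : ℕ} (h : IsMaximalPair S n m l)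
    (hb : n ≤ b) (hb2 : b ≤ n + l) (hm : m ≤ b') (hm2 : b' ≤ m + l) :
    ((b : ℤ) - n) - (b' - m) ∈ shifts S b b' := by
  rw [shifts, Finset.mem_insert, Finset.mem_union, Finset.mem_image, Finset.mem_image]
  rcases lt_trichotomy (b - n) (b' - m) with hlt | heq | hlt
  · exact Or.inr (Or.inr ⟨_, mem_overlaps.2 (h.swap.isOverlap hm hm2 hb hlt), by omega⟩)
  · left; omega
  · exact Or.inr (Or.inl ⟨_, mem_overlaps.2 (h.isOverlap hb hb2 hm hlt), by omega⟩)

/-- The places at which the right extensions of the maximal repeats are to be found. -/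
noncomputable def places (S : List α) (F : List (List α)) : Finset ((_ : ℕ × ℕ) × ℤ) :=
  (boundaries F ×ˢ boundaries F).sigma (fun b => shifts S b.1 b.2)

theorem card_places_le {S : List α} (hS : S ≠ []) (F : List (List α)) {q : ℕ}
    (hq : ¬ ContainsPower q S) :
    ((places S F).card : ℝ) ≤ (F.length + 1) ^ 2 * (4 * q * Real.logb q S.length + 3) := by
  have hq1 : (1 : ℝ) < q := by exact_mod_cast two_le_of_not_containsPower hS hq
  have hlog : 0 ≤ Real.logb q S.length :=
    Real.logb_nonneg hq1 (by exact_mod_cast List.length_pos_iff.2 hS)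
  rw [places, Finset.card_sigma, Nat.cast_sum]
  refine (Finset.sum_le_card_nsmul _ _ _ fun b _ => card_shifts_le hS hq b.1 b.2).trans ?_
  rw [nsmul_eq_mul, Finset.card_product]
  refine mul_le_mul_of_nonneg_right ?_ (by positivity)
  rw [sq]
  exact_mod_cast Nat.mul_le_mul (card_boundaries_le F) (card_boundaries_le F)

theorem rightExtensions_finite_card {S : List α} {F : List (List α)} (hF : IsLZ77 S F) :
    (rightExtensions S).Finite ∧ (rightExtensions S).ncard ≤ (places S F).card := by
  classical
  have key : ∀ R ∈ rightExtensions S, ∃ t ∈ places S F, ∃ n m l, IsMaximalPair S n m l ∧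
      n ≤ t.1.1 ∧ t.1.1 ≤ n + l ∧ m ≤ t.1.2 ∧ ((t.1.1 : ℤ) - n) - (t.1.2 - m) = t.2 ∧
      R = window S n (l + 1) := by
    intro R hR
    obtain ⟨n, m, l, hp, ⟨b, hb, hb1, hb2⟩, ⟨b', hb', hb1', hb2'⟩, hw⟩ :=
      exists_maximalPair_of_mem_rightExtensions hF hR
    exact ⟨⟨(b, b'), ((b : ℤ) - n) - (b' - m)⟩, Finset.mem_sigma.2
      ⟨Finset.mem_product.2 ⟨hb, hb'⟩, hp.shift_mem hb1 hb2 hb1' hb2'⟩,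
      n, m, l, hp, hb1, hb2, hb1', rfl, hw⟩
  choose! φ hφ n m l hp h1 h2 h3 h4 h5 using key
  have hinj : Set.InjOn φ (rightExtensions S) := by
    intro R hR R' hR' heq
    have g1 := h1 R' hR'
    have g2 := h2 R' hR'
    have g3 := h3 R' hR'
    have g4 := h4 R' hR'
    rw [← heq] at g1 g2 g3 g4
    obtain ⟨e1, e2⟩ := (hp R hR).unique (hp R' hR') (h1 R hR) (h2 R hR) g1 g2 (h3 R hR) g3
      ((h4 R hR).trans g4.symm)
    rw [h5 R hR, h5 R' hR', e1, e2]
  have hmaps : Set.MapsTo φ (rightExtensions S) (places S F : Set _) := hφ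
  refine ⟨Set.Finite.of_injOn hmaps hinj (Finset.finite_toSet _), ?_⟩
  rw [← Set.ncard_coe_finset]
  exact Set.ncard_le_ncard_of_injOn φ hmaps hinj (Finset.finite_toSet _)

/-! ### Arcs of the CDAWG -/

theorem IsImplication.unique {w x a b a' b' : List α} (hx : x <:+: w) (h : IsImplication w x a b)
    (h' : IsImplication w x a' b') : a = a' ∧ b = b' := by
  obtain ⟨u, v, huv⟩ := hx
  obtain ⟨h1, h2⟩ := h.1 u v huv.symm
  obtain ⟨h1', h2'⟩ := h'.1 u v huv.symm
  have h3 := h.2 _ _ h'.1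
  have h3' := h'.2 _ _ h.1
  exact ⟨(List.suffix_of_suffix_length_le h1 h1' h3'.1).eq_of_length (by omega),
    (List.prefix_of_prefix_length_le h2 h2' h3'.2).eq_of_length (by omega)⟩

/-- If the same character followed every occurrence of x, it would belong to the implication;
likewise on the left. The two mismatches are then merged by `exists_ne_ne`. -/
theorem isMaximalRepeat_of_mem_cdawgNodes {S : List α} {x : List (Option α)} {c : Option α}
    (hx : x ∈ cdawgNodes (terminated S)) (hxc : x ++ [c] <:+: terminated S) (hne : x ≠ []) :
    ∃ P, IsMaximalRepeat S P ∧ x = P.map some := by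
  obtain ⟨n, hn1, hn2, hn3⟩ := infix_terminated_iff.1 hxc
  obtain ⟨l, hl⟩ : ∃ l, l = x.length := ⟨_, rfl⟩
  have hl1 : 1 ≤ l := by rw [hl]; exact List.length_pos_iff.2 hne
  rw [List.length_append, List.length_singleton, ← hl] at hn2 hn3
  rw [window_succ] at hn3
  obtain ⟨hxn, -⟩ := List.append_inj' hn3 rfl
  have hnocc : IsOcc S n l n := ⟨hn1, by omega, rfl⟩
  have hocc : ∀ u v, terminated S = u ++ x ++ v →
      IsOcc S n l (u.length + 1) ∧ v ≠ [] := by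
    intro u v h
    have hw := eq_window_of_terminated_eq h
    rw [← hl, hxn, window_eq_iff] at hw
    have hlen : S.length + 1 = u.length + (l + v.length) := by
      rw [← length_terminated, h, hl]; simp
    -- An occurrence at the end of `S$` would make the last character of x the end marker, but x is
    -- followed by c in one occurrence.
    have hvne : v.length ≠ 0 := by
      intro hv
      have := hw (l - 1) (by omega)
      have := charAt_eq_none.1 (this.trans (charAt_eq_none.2 (Or.inr (by omega))))
      omega
    exact ⟨⟨by omega, by omega, window_eq_iff.2 fun i hi => (hw i hi).symm⟩,
      fun hv => hvne (by simp [hv])⟩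
  have hright : ∃ k, IsOcc S n l k ∧ charAt S (k + l) ≠ charAt S (n + l) := by
    by_contra! hcon
    have := (hx.2.2 [] [charAt S (n + l)] ?_).2
    · simp at this
    · intro u v h
      refine ⟨List.nil_suffix, ?_⟩
      obtain ⟨h1, h2⟩ := hocc u v h
      obtain ⟨d, v', rfl⟩ := List.exists_cons_of_ne_nil h2
      rw [show u ++ x ++ d :: v' = u ++ (x ++ [d]) ++ v' by simp] at h
      have := eq_window_of_terminated_eq h
      rw [List.length_append, List.length_singleton, ← hl, window_succ] at this
      have hd : d = charAt S (u.length + 1 + l) := by simpa using (List.append_inj' this rfl).2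
      rw [hd, hcon _ h1]
      exact ⟨v', rfl⟩
  obtain ⟨r, hr, hrne⟩ := hright
  have hleft : ∃ k, IsOcc S n l k ∧ charAt S (k - 1) ≠ charAt S (n - 1) := by
    by_contra! hcon
    -- The left end marker is not part of `S$`, so the implication says nothing when n = 1. Then the
    -- second occurrence r, which differs from n, has a proper character on its left.
    by_cases hn : n = 1
    · have hr1 := hcon r hr
      rw [hn, Nat.sub_self, show charAt S 0 = none by simp [charAt]] at hr1
      have := charAt_eq_none.1 hr1
      have h1 := hr.1
      have h2 := hr.2.1
      apply hrne
      rw [hn, show r = 1 by omega]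
    · have := (hx.2.2 [charAt S (n - 1)] [] ?_).1
      · simp at this
      · intro u v h
        refine ⟨?_, List.nil_prefix⟩
        obtain ⟨h1, -⟩ := hocc u v h
        have h2 := hcon _ h1
        rw [Nat.add_sub_cancel] at h2
        rcases List.eq_nil_or_concat u with rfl | ⟨u', d, rfl⟩
        · have := charAt_eq_none.1 (h2.symm.trans (by simp [charAt]))
          omega
        · rw [List.concat_eq_append] at *
          rw [show u' ++ [d] ++ x ++ v = u' ++ [d] ++ (x ++ v) by simp] at h
          have := eq_window_of_terminated_eq h
          rw [List.length_singleton] at this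
          simp only [window, List.range_one, List.map_singleton, add_zero, List.cons.injEq,
            and_true] at this
          rw [List.length_append, List.length_singleton] at h2
          rw [← h2, ← this]
          exact ⟨u', rfl⟩
  obtain ⟨k, hk, hkne⟩ := hleft
  obtain ⟨a, b, ha, -, hb, -, h1, h2, -⟩ := exists_ne_ne (P := IsOcc S n l)
    (Q := fun _ => True) (f := fun k => charAt S (k - 1)) (g := fun k => charAt S (k + l))
    (fun k hk => ⟨k, hk, trivial, rfl⟩) (fun k hk => ⟨k, hk, trivial, rfl⟩)
    hk hnocc hkne hr hnocc hrne hnocc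
  exact ⟨_, ⟨a, b, l, ha.isMaximalPair hl1 hb h1 h2, rfl⟩, by
    rw [map_some_take_drop ha.1 ha.2.1, ha.2.2, hxn]⟩

/-- The map sending an arc to its tail followed by the first character of its label is injective,
because the implication of that string fixes the rest. -/
theorem cdawgArcs_finite_card {S : List α} {F : List (List α)} (hF : IsLZ77 S F) :
    (cdawgArcs (terminated S)).Finite ∧
      (cdawgArcs (terminated S)).ncard ≤ (rightExtensions S).ncard + (F.length + 1) := by
  classical
  set C : Finset (List (Option α)) := (boundaries F).image (fun b => [charAt S b]) with hC
  have hCcard : C.card ≤ F.length + 1 := Finset.card_image_le.trans (card_boundaries_le F)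
  set φ : List (Option α) × List (Option α) × List (Option α) → List (Option α) :=
    fun e => e.1 ++ e.2.1.take 1 with hφ
  have hfin : (rightExtensions S ∪ (C : Set (List (Option α)))).Finite :=
    (rightExtensions_finite_card hF).1.union (Finset.finite_toSet _)
  have hmaps : Set.MapsTo φ (cdawgArcs (terminated S)) (rightExtensions S ∪ C) := by
    rintro e ⟨x, c, a, b, hx, hxc, -, rfl⟩
    simp only [hφ, List.take_succ_cons, List.take_zero]
    rcases eq_or_ne x [] with rfl | hne
    · right
      obtain ⟨k, hk1, hk2, hk3⟩ := infix_terminated_iff.1 hxc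
      simp only [List.nil_append, List.length_singleton, window, List.range_one,
        List.map_singleton, add_zero] at hk2 hk3
      obtain ⟨d, hd, hd'⟩ := exists_boundary_charAt_eq hF hk1 (by omega)
      rw [hC, Finset.mem_coe, Finset.mem_image]
      exact ⟨d, hd, by rw [hd', List.nil_append, hk3]⟩
    · left
      obtain ⟨P, hP, hxP⟩ := isMaximalRepeat_of_mem_cdawgNodes hx hxc hne
      exact ⟨P, c, hP, by rw [hxP], hxc⟩
  have hinj : Set.InjOn φ (cdawgArcs (terminated S)) := by
    rintro e ⟨x, c, a, b, hx, hxc, hi, rfl⟩ e' ⟨x', c', a', b', hx', hxc', hi', rfl⟩ heq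
    simp only [hφ, List.take_succ_cons, List.take_zero] at heq
    obtain ⟨rfl, hc⟩ := List.append_inj' heq rfl
    obtain rfl : c = c' := by simpa using hc
    obtain ⟨rfl, rfl⟩ := hi.unique hxc hi'
    rfl
  refine ⟨Set.Finite.of_injOn hmaps hinj hfin, ?_⟩
  refine (Set.ncard_le_ncard_of_injOn φ hmaps hinj hfin).trans ((Set.ncard_union_le _ _).trans ?_)
  rw [Set.ncard_coe_finset]
  omega

end RepeatWord

theorem mainTheorem2 {α : Type*} (S : List α) (hS : S ≠ []) (F : List (List α))
    (hF : IsLZ77 S F) (z : ℕ) (hz : z = F.length) (q : ℕ) (hq : ¬ ContainsPower q S) :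
    ((rightExtensions S).Finite ∧
      ((rightExtensions S).ncard : ℝ) ≤
        18 * q * (1 + Real.logb q S.length) * (z + 2) ^ 2 - (z + 1)) ∧
    ((cdawgArcs (terminated S)).Finite ∧
      ((cdawgArcs (terminated S)).ncard : ℝ) ≤
        18 * q * (1 + Real.logb q S.length) * (z + 2) ^ 2) := by
  subst hz
  obtain ⟨hfin, hcard⟩ := rightExtensions_finite_card hF
  obtain ⟨hfin', hcard'⟩ := cdawgArcs_finite_card hF
  have hplaces := card_places_le hS F hq
  have hq2 : (2 : ℝ) ≤ q := by exact_mod_cast two_le_of_not_containsPower hS hq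
  have hlog : 0 ≤ Real.logb q S.length :=
    Real.logb_nonneg (by linarith) (by exact_mod_cast List.length_pos_iff.2 hS)
  have hz : (0 : ℝ) ≤ F.length := Nat.cast_nonneg _
  have hcardR : ((rightExtensions S).ncard : ℝ) ≤ (places S F).card := by exact_mod_cast hcard
  have hcardR' : ((cdawgArcs (terminated S)).ncard : ℝ) ≤
      (rightExtensions S).ncard + (F.length + 1) := by exact_mod_cast hcard'
  have hbound : ((rightExtensions S).ncard : ℝ) ≤
      18 * q * (1 + Real.logb q S.length) * (F.length + 2) ^ 2 - (F.length + 1) := by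
    have hX : 4 * q * Real.logb q S.length + 3 ≤ 18 * q * (1 + Real.logb q S.length) := by
      have : 0 ≤ q * Real.logb q S.length := by positivity
      nlinarith
    have hX1 : 1 ≤ 18 * q * (1 + Real.logb q S.length) := by nlinarith
    have h1 := mul_le_mul_of_nonneg_left hX (sq_nonneg ((F.length : ℝ) + 1))
    -- (z + 2)² exceeds (z + 1)² by 2z + 3, which pays for the subtracted z + 1.
    have h2 := mul_le_mul_of_nonneg_right hX1 (by positivity : (0 : ℝ) ≤ 2 * F.length + 3)
    nlinarith
  exact ⟨⟨hfin, hbound⟩, hfin', by linarith⟩
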